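/- Let $d_x\ge 0$, $d_y\ge 1$ and let $f:\mathbb R^{d_x}\times\mathbb R^{d_y}\to\mathbb R$ be twice differentiable. Assume that there are constants $\ell,\rho,\mu>0$ such that, for the Euclidean norm on vectors and the spectral norm on matrices, $\nabla f$ is $\ell$-Lipschitz and $\nabla^2 f$ is $\rho$-Lipschitz on $\mathbb R^{d_x}\times\mathbb R^{d_y}$, and $f(x,\cdot)$ is $\mu$-strongly concave for every $x$. Put $P(x)=\max_{y}f(x,y)$ and assume $P^*=\inf_x P(x)>-\infty$. Let $\kappa=\ell/\mu$, $M=4\sqrt2\,\kappa^3\rho$, $\varepsilon>0$, $x_0\in\mathbb R^{d_x}$, $\eta=1/\ell$, $\theta=(\sqrt\kappa-1)/(\sqrt\kappa+1)$ and $T=\lceil 192(P(x_0)-P^*)\sqrt M\,\varepsilon^{-3/2}\rceil+1$. For a differentiable $h:\mathbb R^{d_y}\to\mathbb R$, let $\mathrm{AGD}(h,v_0,K)$ be the point $v_K$ obtained from $\tilde v_0=v_0$, $v_{k+1}=\tilde v_k-\eta\nabla h(\tilde v_k)$, $\tilde v_{k+1}=v_{k+1}+\theta(v_{k+1}-v_k)$.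 Minimax Cubic Newton with AGD step numbers $K_0,K_1,\dots\in\mathbb N$ does the following. Set $y_{-1}=0$. For $t=0,\dots,T-1$: 1. $y_t=\mathrm{AGD}(-f(x_t,\cdot),y_{t-1},K_t)$; 2. $g_t=\nabla_x f(x_t,y_t)$ and $H_t=\nabla^2_{xx}f-\nabla^2_{xy}f\,(\nabla^2_{yy}f)^{-1}\,\nabla^2_{yx}f$ evaluated at $(x_t,y_t)$; 3. $s_t^*$ is a global minimizer of $s\mapsto g_t^\top s+\frac12 s^\top H_t s+\frac M6\|s\|^3$ over $\mathbb R^{d_x}$; 4. if $\|s_t^*\|\le\frac12\sqrt{\varepsilon/M}$, then leave the loop; otherwise put $x_{t+1}=x_t+s_t^*$. The output is $\hat x=x_\tau+s_\tau^*$, where $\tau$ is the index of the last round executed. Suppose that the numbers $K_t$ are such that, in every round $t\le\tau$, $$\|\nabla P(x_t)-g_t\|\le\tfrac1{192}\,\varepsilon\qquad\text{and}\qquad\|\nabla^2P(x_t)-H_t\|\le\tfrac1{48}\sqrt{M\varepsilon}.$$ Then $\hat x$ is an $(\varepsilon,\sqrt{M\varepsilon})$-second-order stationary point of $P$, that is,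 $P$ is twice differentiable at $\hat x$, $\|\nabla P(\hat x)\|\le\varepsilon$ and $\nabla^2P(\hat x)\succeq-\sqrt{M\varepsilon}\,I$. -/

import Mathlib

open scoped Gradient

noncomputable section

namespace Minimax

/-- `ℝ^d` with the Euclidean norm. -/
abbrev Vec (d : ℕ) : Type := EuclideanSpace ℝ (Fin d)

/-- `ℝ^{dx} × ℝ^{dy}` with the Euclidean norm `‖(x, y)‖² = ‖x‖² + ‖y‖²`. -/
abbrev Joint (dx dy : ℕ) : Type := WithLp 2 (Vec dx × Vec dy)

/-- The point `(x, y)` of `ℝ^{dx} × ℝ^{dy}`. -/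
def pair {dx dy : ℕ} (x : Vec dx) (y : Vec dy) : Joint dx dy := WithLp.toLp 2 (x, y)

/-- The Hessian `∇² φ (z)`, as a linear operator; its norm is the spectral norm. -/
def hessian {V : Type*} [NormedAddCommGroup V] [InnerProductSpace ℝ V] [CompleteSpace V]
    (φ : V → ℝ) (z : V) : V →L[ℝ] V :=
  fderiv ℝ (∇ φ) z

section Blocks

variable {dx dy : ℕ}

/-- The inclusion `u ↦ (u, 0)`. -/
def inX : Vec dx →L[ℝ] Joint dx dy :=
  (WithLp.prodContinuousLinearEquiv 2 ℝ (Vec dx) (Vec dy)).symm.toContinuousLinearMap ∘L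
    ContinuousLinearMap.inl ℝ (Vec dx) (Vec dy)

/-- The inclusion `v ↦ (0, v)`. -/
def inY : Vec dy →L[ℝ] Joint dx dy :=
  (WithLp.prodContinuousLinearEquiv 2 ℝ (Vec dx) (Vec dy)).symm.toContinuousLinearMap ∘L
    ContinuousLinearMap.inr ℝ (Vec dx) (Vec dy)

/-- The projection `(u, v) ↦ u`. -/
def prX : Joint dx dy →L[ℝ] Vec dx := WithLp.fstL 2 ℝ (Vec dx) (Vec dy)

/-- The projection `(u, v) ↦ v`. -/
def prY : Joint dx dy →L[ℝ] Vec dy := WithLp.sndL 2 ℝ (Vec dx) (Vec dy)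

/-- The partial gradient `∇ₓ f (z)`: the `x`-part of the gradient. -/
def gradX (f : Joint dx dy → ℝ) (z : Joint dx dy) : Vec dx := prX (∇ f z)

/-- The block `∇²ₓₓ f (z)` of the Hessian. -/
def hessXX (f : Joint dx dy → ℝ) (z : Joint dx dy) : Vec dx →L[ℝ] Vec dx :=
  prX ∘L hessian f z ∘L inX

/-- The block `∇²ₓᵧ f (z)` of the Hessian, of size `dx × dy`. -/
def hessXY (f : Joint dx dy → ℝ) (z : Joint dx dy) : Vec dy →L[ℝ] Vec dx :=
  prX ∘L hessian f z ∘L inY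

/-- The block `∇²ᵧₓ f (z)` of the Hessian, of size `dy × dx`. -/
def hessYX (f : Joint dx dy → ℝ) (z : Joint dx dy) : Vec dx →L[ℝ] Vec dy :=
  prY ∘L hessian f z ∘L inX

/-- The block `∇²ᵧᵧ f (z)` of the Hessian. -/
def hessYY (f : Joint dx dy → ℝ) (z : Joint dx dy) : Vec dy →L[ℝ] Vec dy :=
  prY ∘L hessian f z ∘L inY

/-- `∇²ₓₓ f - ∇²ₓᵧ f (∇²ᵧᵧ f)⁻¹ ∇²ᵧₓ f` at the point `z`. -/
def schurHessian (f : Joint dx dy → ℝ) (z : Joint dx dy) : Vec dx →L[ℝ] Vec dx :=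
  hessXX f z - hessXY f z ∘L (hessYY f z).inverse ∘L hessYX f z

/-- The primal function `P(x) = max_y f(x, y)`, written as a supremum. -/
def primal (f : Joint dx dy → ℝ) (x : Vec dx) : ℝ := ⨆ y : Vec dy, f (pair x y)

end Blocks

/-- `x` is an `(ε, δ)`-second-order stationary point of `P`: `P` is twice differentiable at `x`,
`‖∇P(x)‖ ≤ ε` and `∇²P(x) ⪰ -δ I`. -/
structure IsSSP {d : ℕ} (P : Vec d → ℝ) (ε δ : ℝ) (x : Vec d) : Prop where
  differentiable_near : ∀ᶠ z in nhds x, DifferentiableAt ℝ P z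
  differentiableAt_gradient : DifferentiableAt ℝ (∇ P) x
  norm_gradient_le : ‖∇ P x‖ ≤ ε
  hessian_ge : (hessian P x + δ • ContinuousLinearMap.id ℝ (Vec d)).IsPositive

/-- The iterates `(y_k, ỹ_k)` of accelerated gradient descent:
`ỹ_0 = y_0`, `y_{k+1} = ỹ_k - η ∇h(ỹ_k)`, `ỹ_{k+1} = y_{k+1} + θ (y_{k+1} - y_k)`. -/
def agdIter {d : ℕ} (h : Vec d → ℝ) (y₀ : Vec d) (η θ : ℝ) : ℕ → Vec d × Vec d
  | 0 => (y₀, y₀)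
  | k + 1 =>
    let y := (agdIter h y₀ η θ k).1
    let y' := (agdIter h y₀ η θ k).2
    let yNext := y' - η • ∇ h y'
    (yNext, yNext + θ • (yNext - y))

/-- `AGD(h, y₀, K, η, θ)`: the point `y_K`. -/
def AGD {d : ℕ} (h : Vec d → ℝ) (y₀ : Vec d) (K : ℕ) (η θ : ℝ) : Vec d :=
  (agdIter h y₀ η θ K).1

/-- The cubic model `s ↦ gᵀ s + (1/2) sᵀ H s + (M/6) ‖s‖³`. -/
def cubicModel {d : ℕ} (g : Vec d) (H : Vec d →L[ℝ] Vec d) (M : ℝ) (s : Vec d) : ℝ :=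
  inner ℝ g s + (1 / 2) * inner ℝ s (H s) + (M / 6) * ‖s‖ ^ 3

/-- A run of Minimax Cubic Newton on `f`, with parameters `ℓ`, `κ`, `M`, starting point `x₀`,
at most `T` rounds, `K t` steps of AGD in round `t`, and accuracy `ε`.
The last round executed is round `τ`; only the values of `x`, `y`, `s` at times `t ≤ τ` matter.
The minimiser of the cubic model need not be unique; `s t` may be any one of them.
The output of the run is `x τ + s τ`. -/
structure IsMCNRun {dx dy : ℕ} (f : Joint dx dy → ℝ) (ℓ κ M : ℝ) (x₀ : Vec dx) (T : ℕ)
    (K : ℕ → ℕ) (ε : ℝ) (x : ℕ → Vec dx) (y : ℕ → Vec dy) (s : ℕ → Vec dx) (τ : ℕ) : Prop where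
  x_zero : x 0 = x₀
  y_zero : y 0 =
    AGD (fun v => -f (pair (x 0) v)) 0 (K 0) (1 / ℓ) ((√κ - 1) / (√κ + 1))
  y_succ : ∀ t, t + 1 ≤ τ → y (t + 1) =
    AGD (fun v => -f (pair (x (t + 1)) v)) (y t) (K (t + 1)) (1 / ℓ) ((√κ - 1) / (√κ + 1))
  /-- `s_t` minimises the cubic model built from `g_t` and `H_t`. -/
  s_min : ∀ t ≤ τ, ∀ u : Vec dx,
    cubicModel (gradX f (pair (x t) (y t))) (schurHessian f (pair (x t) (y t))) M (s t) ≤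
      cubicModel (gradX f (pair (x t) (y t))) (schurHessian f (pair (x t) (y t))) M u
  /-- Before round `τ` the break condition fails, and the iteration continues. -/
  no_break : ∀ t < τ, ¬ ‖s t‖ ≤ (1 / 2) * √(ε / M)
  x_succ : ∀ t < τ, x (t + 1) = x t + s t
  /-- The rounds are `0, …, T - 1`. -/
  lt_rounds : τ < T
  /-- Round `τ` is the last one because of the break condition or because the loop is over. -/
  last_round : ‖s τ‖ ≤ (1 / 2) * √(ε / M) ∨ τ + 1 = T

end Minimax

end

/-!
The theorem combines the regularity of the primal function `P` with the analysis of a cubic Newton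
method that uses inexact derivatives.

*Regularity of `P`.* By strong concavity, `f (x, ·)` has a maximizer `Y x`, and strong monotonicity
of `-∇ᵧ f` makes `Y` Lipschitz with constant `κ = ℓ / μ`. The equation `∇ᵧ f (x, Y x) = 0` then
shows that `Y` is differentiable (`IsRegular.hasFDerivAt_argmax`), so `∇P(x) = ∇ₓ f (x, Y x)`, and
`∇²P(x)` is the Schur complement of `∇²ᵧᵧ f` at `(x, Y x)`
(`IsRegular.hasFDerivAt_gradient_primal`). With `W = [I; -(∇²ᵧᵧ f)⁻¹ ∇²ᵧₓ f]` the Schur complement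
satisfies `S(z) - S(z') = W(z)ᵀ (∇²f(z) - ∇²f(z')) W(z')`. Since `‖W‖ ≤ √2 κ`, and `x ↦ (x, Y x)` is
`√2 κ`-Lipschitz, `∇²P` is Lipschitz with constant `2 √2 κ³ ρ = M / 2`
(`IsRegular.norm_hessian_primal_sub_le`). The spare factor `2` allows the use of Taylor bounds
with non-sharp constants.

*The cubic model.* A global minimizer `s` satisfies `g + H s + (M / 2) ‖s‖ s = 0` and
`H + (M / 2) ‖s‖ I ⪰ 0` (`cubicModel_gradient_eq_zero`, `cubicModel_second_order`), and hence
the model value at `s` is at most `-(M / 12) ‖s‖³`. With the assumed accuracy of `g` and `H`, a step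
longer than `√(ε / M) / 2` decreases `P` by more than `ε ^ (3 / 2) / (192 √M)`
(`cubicStep_decrease`), and a step that is not longer ends at a second-order stationary point
(`cubicStep_isSSP`).

*The number of rounds.* `T` long steps would bring `P` below its infimum, so the last step is a
short one.
-/

namespace Minimax

open Filter Topology

/-! ### Strongly concave functions -/

section General

variable {V : Type*} [NormedAddCommGroup V] [InnerProductSpace ℝ V] [CompleteSpace V]

theorem hasDerivAt_comp_line {φ : V → ℝ} {x d : V} {t : ℝ}
    (h : DifferentiableAt ℝ φ (x + t • d)) :
    HasDerivAt (fun r : ℝ => φ (x + r • d)) (inner ℝ (∇ φ (x + t • d)) d) t := by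
  have h1 : HasDerivAt (fun r : ℝ => x + r • d) d t := by
    simpa using ((hasDerivAt_id t).smul_const d).const_add x
  have h2 := h.hasFDerivAt.comp_hasDerivAt t h1
  rw [inner_gradient_left]
  exact h2

theorem le_add_inner_gradient_of_strongConcaveOn {h : V → ℝ} {μ : ℝ}
    (hc : StrongConcaveOn Set.univ μ h) {y : V} (hy : DifferentiableAt ℝ h y) (y' : V) :
    h y' ≤ h y + inner ℝ (∇ h y) (y' - y) - μ / 2 * ‖y' - y‖ ^ 2 := by
  have hd : HasDerivAt (fun r : ℝ => h (y + r • (y' - y))) (inner ℝ (∇ h y) (y' - y)) 0 := by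
    simpa using hasDerivAt_comp_line (φ := h) (x := y) (d := y' - y) (t := 0) (by simpa using hy)
  have hlim := hd.tendsto_slope_zero_right
  have hlim2 : Tendsto (fun t : ℝ => h y' - h y + (1 - t) * (μ / 2 * ‖y' - y‖ ^ 2)) (𝓝[>] 0)
      (𝓝 (h y' - h y + (1 - 0) * (μ / 2 * ‖y' - y‖ ^ 2))) :=
    (Continuous.tendsto (by fun_prop) _).mono_left nhdsWithin_le_nhds
  have key := le_of_tendsto_of_tendsto hlim2 hlim (by
    filter_upwards [Ioo_mem_nhdsGT (zero_lt_one' ℝ)] with t ht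
    have hineq := hc.2 (Set.mem_univ y') (Set.mem_univ y) ht.1.le (sub_nonneg.2 ht.2.le)
      (by ring)
    have heq : t • y' + (1 - t) • y = y + t • (y' - y) := by module
    rw [heq] at hineq
    simp only [smul_eq_mul, zero_add, zero_smul, add_zero] at hineq ⊢
    rw [inv_mul_eq_div, le_div_iff₀ ht.1]
    linarith)
  linarith

theorem inner_gradient_sub_le_of_strongConcaveOn {h : V → ℝ} {μ : ℝ}
    (hc : StrongConcaveOn Set.univ μ h) (hd : Differentiable ℝ h) (y y' : V) :
    inner ℝ (∇ h y - ∇ h y') (y - y') ≤ -(μ * ‖y - y'‖ ^ 2) := by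
  have h1 := le_add_inner_gradient_of_strongConcaveOn hc (hd y) y'
  have h2 := le_add_inner_gradient_of_strongConcaveOn hc (hd y') y
  rw [norm_sub_rev, ← neg_sub y y', inner_neg_right] at h1
  rw [inner_sub_left]
  linarith

theorem exists_forall_le_of_strongConcaveOn [FiniteDimensional ℝ V] {h : V → ℝ} {μ : ℝ}
    (hμ : 0 < μ) (hc : StrongConcaveOn Set.univ μ h) (hd : Differentiable ℝ h) :
    ∃ y, ∀ y', h y' ≤ h y := by
  refine hd.continuous.exists_forall_ge' (x₀ := 0) ?_
  have hb : ∀ᶠ v : V in cocompact V, ‖∇ h 0‖ / (μ / 2) ≤ ‖v‖ :=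
    (tendsto_norm_cocompact_atTop (E := V)).eventually_ge_atTop _
  filter_upwards [hb] with v hv
  have h1 := le_add_inner_gradient_of_strongConcaveOn hc (hd 0) v
  have h2 := real_inner_le_norm (∇ h 0) v
  rw [div_le_iff₀ (by positivity)] at hv
  simp only [sub_zero] at h1
  nlinarith [mul_le_mul_of_nonneg_right hv (norm_nonneg v)]

/-! ### Second-order Taylor bounds under a Lipschitz Hessian -/

theorem isSymmetric_hessian {φ : V → ℝ} (h1 : Differentiable ℝ φ) {z : V}
    (h2 : DifferentiableAt ℝ (∇ φ) z) : (hessian φ z).IsSymmetric := by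
  intro v w
  have hL : HasFDerivAt (fun x => (InnerProductSpace.toDual ℝ V) (∇ φ x))
      ((InnerProductSpace.toDual ℝ V).toContinuousLinearEquiv.toContinuousLinearMap ∘L
        hessian φ z) z :=
    ((InnerProductSpace.toDual ℝ V).toContinuousLinearEquiv.toContinuousLinearMap.hasFDerivAt).comp
      z h2.hasFDerivAt
  have := second_derivative_symmetric (𝕜 := ℝ) (fun x => (h1 x).hasGradientAt.hasFDerivAt) hL v w
  simpa [real_inner_comm] using this

/-- The first-order expansion of the gradient. The mean value inequality gives the constant `L`
instead of the sharp `L / 2`. -/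
theorem norm_gradient_add_sub_le {φ : V → ℝ} {L : ℝ} (hL : 0 ≤ L) (h2 : Differentiable ℝ (∇ φ))
    (hlip : ∀ z z', ‖hessian φ z - hessian φ z'‖ ≤ L * ‖z - z'‖) (x s : V) :
    ‖∇ φ (x + s) - ∇ φ x - hessian φ x s‖ ≤ L * ‖s‖ ^ 2 := by
  have hc : Convex ℝ (Metric.closedBall x ‖s‖) := convex_closedBall _ _
  have key := hc.norm_image_sub_le_of_norm_hasFDerivWithin_le' (f := ∇ φ) (f' := hessian φ)
    (φ := hessian φ x) (C := L * ‖s‖) (x := x) (y := x + s)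
    (fun z _ => (h2 z).hasFDerivAt.hasFDerivWithinAt) (fun z hz => by
      refine (hlip z x).trans ?_
      rw [mem_closedBall_iff_norm] at hz
      gcongr) (by simp) (by simp)
  simpa [sq, mul_assoc] using key

/-- The second-order expansion of the function, with `L / 3` in place of the sharp `L / 6`. -/
theorem le_taylor_add_cube {φ : V → ℝ} {L : ℝ} (hL : 0 ≤ L) (h1 : Differentiable ℝ φ)
    (h2 : Differentiable ℝ (∇ φ))
    (hlip : ∀ z z', ‖hessian φ z - hessian φ z'‖ ≤ L * ‖z - z'‖) (x s : V) :
    φ (x + s) ≤ φ x + inner ℝ (∇ φ x) s + 1 / 2 * inner ℝ s (hessian φ x s)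
      + L / 3 * ‖s‖ ^ 3 := by
  let ψ : ℝ → ℝ := fun t => φ (x + t • s) - t * inner ℝ (∇ φ x) s
    - t ^ 2 * (1 / 2 * inner ℝ s (hessian φ x s)) - t ^ 3 * (L / 3 * ‖s‖ ^ 3)
  have hψ : ∀ t, HasDerivAt ψ (inner ℝ (∇ φ (x + t • s)) s - 1 * inner ℝ (∇ φ x) s
      - (2 * t) * (1 / 2 * inner ℝ s (hessian φ x s)) - (3 * t ^ 2) * (L / 3 * ‖s‖ ^ 3)) t := by
    intro t
    refine (((hasDerivAt_comp_line (h1 _)).sub ((hasDerivAt_id t).mul_const _)).sub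
      (HasDerivAt.mul_const ?_ _)).sub (HasDerivAt.mul_const ?_ _)
    · simpa using hasDerivAt_pow 2 t
    · simpa using hasDerivAt_pow 3 t
  -- By the expansion of the gradient along the segment, `ψ' ≤ 0`.
  have hanti : AntitoneOn ψ (Set.Icc 0 1) := by
    refine antitoneOn_of_deriv_nonpos (convex_Icc 0 1)
      (fun t _ => (hψ t).continuousAt.continuousWithinAt)
      (fun t _ => (hψ t).differentiableAt.differentiableWithinAt) (fun t ht => ?_)
    rw [(hψ t).deriv]
    have hb := norm_gradient_add_sub_le hL h2 hlip x (t • s)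
    have hi := (real_inner_le_norm (∇ φ (x + t • s) - ∇ φ x - hessian φ x (t • s)) s).trans
      (mul_le_mul_of_nonneg_right hb (norm_nonneg s))
    rw [inner_sub_left, inner_sub_left, map_smul, real_inner_smul_left,
      real_inner_comm s (hessian φ x s), norm_smul, mul_pow, Real.norm_eq_abs, sq_abs] at hi
    linarith
  have h01 := hanti (Set.left_mem_Icc.2 zero_le_one) (Set.right_mem_Icc.2 zero_le_one) zero_le_one
  simp only [ψ, zero_smul, one_smul, add_zero] at h01
  linarith

end General

/-! ### Global minimizers of the cubic model -/

section Cubic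

variable {d : ℕ} {g s : Vec d} {H : Vec d →L[ℝ] Vec d} {M : ℝ}

theorem cubicModel_gradient_eq_zero (hH : H.IsSymmetric)
    (hs : ∀ u, cubicModel g H M s ≤ cubicModel g H M u) :
    g + H s + (M / 2 * ‖s‖) • s = 0 := by
  set p := g + H s + (M / 2 * ‖s‖) • s with hp
  have hcube : HasFDerivAt (fun u : Vec d => ‖u‖ ^ 3) ((3 * ‖s‖) • innerSL ℝ s) s := by
    have := hasFDerivAt_norm_rpow s (p := 3) (by norm_num)
    norm_num at this
    exact_mod_cast this
  have hquad : HasFDerivAt (fun u : Vec d => inner ℝ u (H u))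
      ((2 : ℝ) • innerSL ℝ (H s)) s := by
    refine ((hasFDerivAt_id s).inner ℝ H.hasFDerivAt).congr_fderiv ?_
    ext v
    have hsym : inner ℝ (H s) v = inner ℝ s (H v) := hH s v
    simp [hsym, real_inner_comm (H s) v, two_mul]
  have hlin : HasFDerivAt (fun u : Vec d => inner ℝ g u) (innerSL ℝ g) s :=
    (innerSL ℝ g).hasFDerivAt
  have hmin : IsLocalMin (cubicModel g H M) s := Eventually.of_forall hs
  have hz := hmin.hasFDerivAt_eq_zero
    ((hlin.add (hquad.const_mul (1 / 2))).add (hcube.const_mul (M / 6)))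
  have hz' := DFunLike.congr_fun hz p
  have : inner ℝ p p = 0 := by
    conv_lhs => rw [hp]
    rw [← hp, inner_add_left, inner_add_left, real_inner_smul_left]
    simp at hz'
    linarith
  exact inner_self_eq_zero.1 this

/-- The increment of the cubic model from a stationary point `s`. -/
theorem cubicModel_sub_eq (hH : H.IsSymmetric) (hg : g + H s + (M / 2 * ‖s‖) • s = 0)
    (d' : Vec d) :
    cubicModel g H M (s + d') - cubicModel g H M s =
      1 / 2 * (inner ℝ d' (H d') + M / 2 * ‖s‖ * ‖d'‖ ^ 2)
        + M / 12 * (‖s + d'‖ - ‖s‖) ^ 2 * (2 * ‖s + d'‖ + ‖s‖) := by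
  have hg' : inner ℝ g d' = -(inner ℝ (H s) d') - M / 2 * ‖s‖ * inner ℝ s d' := by
    have h0 : inner ℝ (g + H s + (M / 2 * ‖s‖) • s) d' = 0 := by rw [hg, inner_zero_left]
    rw [inner_add_left, inner_add_left, real_inner_smul_left] at h0
    linarith
  have hsym : inner ℝ (H s) d' = inner ℝ s (H d') := hH s d'
  have hn := norm_add_sq_real s d'
  have hn' : inner ℝ s d' = (‖s + d'‖ ^ 2 - ‖s‖ ^ 2 - ‖d'‖ ^ 2) / 2 := by linarith
  simp only [cubicModel, map_add, inner_add_left, inner_add_right, hg',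
    real_inner_comm (H s) d', hsym]
  rw [hn']
  ring

/-- At a global minimizer `s` of the cubic model, `H + (M / 2) ‖s‖ I` is positive semidefinite. -/
theorem cubicModel_second_order (hH : H.IsSymmetric) (hM : 0 ≤ M)
    (hs : ∀ u, cubicModel g H M s ≤ cubicModel g H M u) (v : Vec d) :
    0 ≤ inner ℝ v (H v) + M / 2 * ‖s‖ * ‖v‖ ^ 2 := by
  have hinc := cubicModel_sub_eq hH (cubicModel_gradient_eq_zero hH hs)
  set Q := inner ℝ v (H v) + M / 2 * ‖s‖ * ‖v‖ ^ 2 with hQ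
  have hstep : ∀ t : ℝ, 0 ≤ 1 / 2 * (t ^ 2 * Q)
      + M / 12 * (‖s + t • v‖ - ‖s‖) ^ 2 * (2 * ‖s + t • v‖ + ‖s‖) := by
    intro t
    have h1 := hinc (t • v)
    have h2 := hs (s + t • v)
    have h3 : inner ℝ (t • v) (H (t • v)) + M / 2 * ‖s‖ * ‖t • v‖ ^ 2 = t ^ 2 * Q := by
      rw [hQ, map_smul, real_inner_smul_left, real_inner_smul_right, norm_smul, mul_pow,
        Real.norm_eq_abs, sq_abs]
      ring
    rw [h3] at h1
    linarith
  have hnorm : ∀ t : ℝ, ‖s + t • v‖ ^ 2 = ‖s‖ ^ 2 + 2 * t * inner ℝ s v + t ^ 2 * ‖v‖ ^ 2 := by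
    intro t
    rw [norm_add_sq_real, real_inner_smul_right, norm_smul, mul_pow, Real.norm_eq_abs, sq_abs]
    ring
  by_cases hsv : inner ℝ s v = 0
  · -- Along a tangent direction the norm grows to second order only.
    have hbound : ∀ t : ℝ, 0 < t → 0 ≤ Q + t * (M / 3 * ‖v‖ ^ 3) := by
      intro t ht
      have hn := hnorm t
      rw [hsv, mul_zero, add_zero] at hn
      have ha : ‖s‖ ≤ ‖s + t • v‖ :=
        (sq_le_sq₀ (norm_nonneg _) (norm_nonneg _)).1 (by nlinarith [sq_nonneg (t * ‖v‖)])
      have hb : ‖s + t • v‖ ≤ ‖s‖ + t * ‖v‖ := by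
        simpa [norm_smul, abs_of_pos ht] using norm_add_le s (t • v)
      have h0 := hstep t
      set a := ‖s + t • v‖
      have hprod : (a - ‖s‖) ^ 2 * (2 * a + ‖s‖) ≤ t * ‖v‖ * (2 * (t ^ 2 * ‖v‖ ^ 2)) := by
        calc (a - ‖s‖) ^ 2 * (2 * a + ‖s‖)
            ≤ (a - ‖s‖) ^ 2 * (2 * (a + ‖s‖)) := by
              gcongr; linarith [norm_nonneg s]
          _ = (a - ‖s‖) * (2 * (t ^ 2 * ‖v‖ ^ 2)) := by
              rw [show t ^ 2 * ‖v‖ ^ 2 = a ^ 2 - ‖s‖ ^ 2 by linarith]; ring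
          _ ≤ t * ‖v‖ * (2 * (t ^ 2 * ‖v‖ ^ 2)) := by gcongr; linarith
      have h1 : 0 ≤ t ^ 2 * (Q + t * (M / 3 * ‖v‖ ^ 3)) := by
        have := mul_le_mul_of_nonneg_left hprod (by positivity : 0 ≤ M / 12)
        linarith
      exact nonneg_of_mul_nonneg_right h1 (by positivity)
    have hlim : Tendsto (fun t : ℝ => Q + t * (M / 3 * ‖v‖ ^ 3)) (𝓝[>] 0)
        (𝓝 (Q + 0 * (M / 3 * ‖v‖ ^ 3))) :=
      (Continuous.tendsto (by fun_prop) _).mono_left nhdsWithin_le_nhds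
    have := ge_of_tendsto hlim (eventually_mem_nhdsWithin.mono hbound)
    linarith
  · -- Reflecting `s` in the hyperplane orthogonal to `v` keeps its norm.
    have hv : 0 < ‖v‖ := norm_pos_iff.2 (by rintro rfl; simp at hsv)
    set t := -(2 * inner ℝ s v) / ‖v‖ ^ 2 with ht
    have hn : ‖s + t • v‖ = ‖s‖ := by
      have : ‖s + t • v‖ ^ 2 = ‖s‖ ^ 2 := by
        rw [hnorm, ht]; field_simp; ring
      exact (pow_left_inj₀ (norm_nonneg _) (norm_nonneg _) two_ne_zero).1 this
    have h0 := hstep t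
    rw [hn, sub_self] at h0
    have ht0 : 0 < t ^ 2 := by
      have : t ≠ 0 := div_ne_zero (neg_ne_zero.2 (mul_ne_zero two_ne_zero hsv)) (by positivity)
      positivity
    have h1 : 0 ≤ t ^ 2 * Q := by linarith
    exact nonneg_of_mul_nonneg_right h1 ht0

theorem cubicModel_le (hH : H.IsSymmetric) (hM : 0 ≤ M)
    (hs : ∀ u, cubicModel g H M s ≤ cubicModel g H M u) :
    cubicModel g H M s ≤ -(M / 12 * ‖s‖ ^ 3) := by
  have hg : inner ℝ (g + H s + (M / 2 * ‖s‖) • s) s = 0 := by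
    rw [cubicModel_gradient_eq_zero hH hs, inner_zero_left]
  have h2 := cubicModel_second_order hH hM hs s
  rw [inner_add_left, inner_add_left, real_inner_smul_left, real_inner_self_eq_norm_sq,
    real_inner_comm s (H s)] at hg
  unfold cubicModel
  nlinarith

end Cubic

/-! ### The blocks of `ℝ^{dx} × ℝ^{dy}` -/

section Blocks

variable {dx dy : ℕ}

theorem pair_eq (x : Vec dx) (y : Vec dy) : pair x y = inX x + inY y := by
  apply (WithLp.equiv 2 (Vec dx × Vec dy)).injective
  ext i <;> simp [pair, inX, inY]

theorem exists_eq_pair (z : Joint dx dy) : ∃ x y, z = pair x y :=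
  ⟨z.fst, z.snd, rfl⟩

theorem pair_sub_pair (x x' : Vec dx) (y y' : Vec dy) :
    pair x y - pair x' y' = inX (x - x') + inY (y - y') := by
  rw [pair_eq, pair_eq, map_sub, map_sub]; abel

theorem inner_inY (z : Joint dx dy) (v : Vec dy) : inner ℝ z (inY v) = inner ℝ (prY z) v := by
  simp [inY, prY, WithLp.prod_inner_apply]

theorem norm_inX_add_inY_sq (u : Vec dx) (v : Vec dy) :
    ‖(inX u + inY v : Joint dx dy)‖ ^ 2 = ‖u‖ ^ 2 + ‖v‖ ^ 2 := by
  rw [WithLp.prod_norm_sq_eq_of_L2]; simp [inX, inY]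

theorem inner_eq_prX_add_prY (z w : Joint dx dy) :
    inner ℝ z w = inner ℝ (prX z) (prX w) + inner ℝ (prY z) (prY w) := by
  simp [prX, prY, WithLp.prod_inner_apply]

theorem norm_inX (u : Vec dx) : ‖(inX u : Joint dx dy)‖ = ‖u‖ := by
  have := norm_inX_add_inY_sq u (0 : Vec dy)
  simpa using this

theorem norm_inY (v : Vec dy) : ‖(inY v : Joint dx dy)‖ = ‖v‖ := by
  have := norm_inX_add_inY_sq (0 : Vec dx) v
  simpa using this

theorem norm_prY_le (z : Joint dx dy) : ‖prY z‖ ≤ ‖z‖ := by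
  have := WithLp.prod_norm_sq_eq_of_L2 z
  refine (sq_le_sq₀ (norm_nonneg _) (norm_nonneg _)).1 ?_
  rw [this]
  exact le_add_of_nonneg_left (sq_nonneg _)

@[simp] theorem prX_inX (u : Vec dx) : prX (inX u : Joint dx dy) = u := by simp [prX, inX]

@[simp] theorem prX_inY (v : Vec dy) : prX (inY v : Joint dx dy) = 0 := by simp [prX, inY]

theorem hasFDerivAt_pair_right (x : Vec dx) (y : Vec dy) :
    HasFDerivAt (fun v : Vec dy => pair x v) inY y := by
  simp_rw [pair_eq]
  exact inY.hasFDerivAt.const_add _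

theorem hasGradientAt_slice {f : Joint dx dy → ℝ} (hf : Differentiable ℝ f) (x : Vec dx)
    (y : Vec dy) : HasGradientAt (fun v => f (pair x v)) (prY (∇ f (pair x y))) y := by
  rw [hasGradientAt_iff_hasFDerivAt]
  refine ((hf _).hasFDerivAt.comp y (hasFDerivAt_pair_right x y)).congr_fderiv ?_
  ext v
  simp [← inner_inY, inner_gradient_left]

end Blocks

/-- The standing assumptions on the objective: `f` is twice differentiable, `∇ f` is `ℓ`-Lipschitz,
`∇² f` is `ρ`-Lipschitz, and `f (x, ·)` is `μ`-strongly concave for every `x`. -/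
structure IsRegular {dx dy : ℕ} (f : Joint dx dy → ℝ) (ℓ ρ μ : ℝ) : Prop where
  pos_ℓ : 0 < ℓ
  pos_ρ : 0 < ρ
  pos_μ : 0 < μ
  differentiable : Differentiable ℝ f
  differentiable_gradient : Differentiable ℝ (∇ f)
  gradient_lipschitz : ∀ z z', ‖∇ f z - ∇ f z'‖ ≤ ℓ * ‖z - z'‖
  hessian_lipschitz : ∀ z z', ‖hessian f z - hessian f z'‖ ≤ ρ * ‖z - z'‖
  strongConcave : ∀ x, StrongConcaveOn Set.univ μ (fun y => f (pair x y))

/-- The map `u ↦ (u, -(∇²ᵧᵧ f)⁻¹ ∇²ᵧₓ f u)`, with the blocks taken at `z`. At a point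
`z = (x, y*(x))` it is the derivative of `x ↦ (x, y*(x))`. -/
noncomputable def liftX {dx dy : ℕ} (f : Joint dx dy → ℝ) (z : Joint dx dy) :
    Vec dx →L[ℝ] Joint dx dy :=
  inX - inY ∘L (hessYY f z).inverse ∘L hessYX f z

namespace IsRegular

variable {dx dy : ℕ} {f : Joint dx dy → ℝ} {ℓ ρ μ : ℝ}

/-! ### The Hessian blocks and the Schur complement -/

section Schur

theorem norm_hessian_apply_le (hf : IsRegular f ℓ ρ μ) (z w : Joint dx dy) :
    ‖hessian f z w‖ ≤ ℓ * ‖w‖ := by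
  refine ContinuousLinearMap.le_of_opNorm_le _ ?_ w
  have hl : LipschitzWith ⟨ℓ, hf.pos_ℓ.le⟩ (∇ f) :=
    LipschitzWith.of_dist_le_mul fun a b => by
      rw [dist_eq_norm, dist_eq_norm]; exact hf.gradient_lipschitz a b
  exact norm_fderiv_le_of_lipschitz ℝ hl

theorem isSymmetric_hessian (hf : IsRegular f ℓ ρ μ) (z : Joint dx dy) :
    (hessian f z).IsSymmetric :=
  Minimax.isSymmetric_hessian hf.differentiable (hf.differentiable_gradient z)

theorem inner_gradY_sub_le (hf : IsRegular f ℓ ρ μ) (x : Vec dx) (y y' : Vec dy) :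
    inner ℝ (prY (∇ f (pair x y)) - prY (∇ f (pair x y'))) (y - y') ≤ -(μ * ‖y - y'‖ ^ 2) := by
  have h := inner_gradient_sub_le_of_strongConcaveOn (hf.strongConcave x)
    (fun v => (hasGradientAt_slice hf.differentiable x v).differentiableAt) y y'
  rwa [(hasGradientAt_slice hf.differentiable x y).gradient,
    (hasGradientAt_slice hf.differentiable x y').gradient] at h

theorem inner_hessYY_le (hf : IsRegular f ℓ ρ μ) (z : Joint dx dy) (v : Vec dy) :
    inner ℝ (hessYY f z v) v ≤ -(μ * ‖v‖ ^ 2) := by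
  obtain ⟨x, y, rfl⟩ := exists_eq_pair z
  have hline : HasDerivAt (fun r : ℝ => y + r • v) v 0 := by
    simpa using ((hasDerivAt_id (0 : ℝ)).smul_const v).const_add y
  have hgrad : HasFDerivAt (fun w => prY (∇ f (pair x w))) (hessYY f (pair x y))
      (y + (0 : ℝ) • v) := by
    rw [zero_smul, add_zero]
    exact (prY : Joint dx dy →L[ℝ] Vec dy).hasFDerivAt.comp y
      ((hf.differentiable_gradient _).hasFDerivAt.comp y (hasFDerivAt_pair_right x y))
  have hd : HasDerivAt (fun r : ℝ => prY (∇ f (pair x (y + r • v))))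
      (hessYY f (pair x y) v) 0 := by
    have hcomp := hgrad.comp_hasDerivAt (0 : ℝ) hline
    exact hcomp
  have hlim := (hd.inner ℝ (hasDerivAt_const (0 : ℝ) v)).tendsto_slope_zero_right
  simp only [inner_zero_right, zero_add] at hlim
  refine le_of_tendsto hlim (eventually_mem_nhdsWithin.mono fun t (ht : 0 < t) => ?_)
  have h := hf.inner_gradY_sub_le x (y + t • v) y
  rw [add_sub_cancel_left, inner_smul_right, norm_smul, mul_pow, Real.norm_eq_abs, sq_abs,
    inner_sub_left] at h
  rw [smul_eq_mul, inv_mul_eq_div, div_le_iff₀ ht]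
  simp only [zero_smul, add_zero]
  refine le_of_mul_le_mul_left ?_ ht
  linarith

theorem mul_norm_le_norm_hessYY (hf : IsRegular f ℓ ρ μ) (z : Joint dx dy) (v : Vec dy) :
    μ * ‖v‖ ≤ ‖hessYY f z v‖ := by
  rcases (norm_nonneg v).eq_or_lt with h0 | h0
  · rw [← h0, mul_zero]; exact norm_nonneg _
  have h1 := hf.inner_hessYY_le z v
  have h2 := neg_le_of_abs_le (abs_real_inner_le_norm (hessYY f z v) v)
  refine le_of_mul_le_mul_right ?_ h0
  linarith

theorem isInvertible_hessYY (hf : IsRegular f ℓ ρ μ) (z : Joint dx dy) :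
    (hessYY f z).IsInvertible := by
  have hinj : Function.Injective (hessYY f z : Vec dy →ₗ[ℝ] Vec dy) := by
    refine (injective_iff_map_eq_zero _).2 fun v hv => ?_
    have h := hf.mul_norm_le_norm_hessYY z v
    rw [show hessYY f z v = 0 from hv, norm_zero] at h
    exact norm_le_zero_iff.1 (nonpos_of_mul_nonpos_right h hf.pos_μ)
  exact ⟨(LinearEquiv.ofInjectiveEndo _ hinj).toContinuousLinearEquiv, by ext; rfl⟩

theorem one_le_conditionNumber (hf : IsRegular f ℓ ρ μ) (hdy : 0 < dy) : 1 ≤ ℓ / μ := by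
  rw [one_le_div hf.pos_μ]
  have : Nonempty (Fin dy) := ⟨⟨0, hdy⟩⟩
  obtain ⟨v, hv⟩ := exists_ne (0 : Vec dy)
  have h1 := hf.mul_norm_le_norm_hessYY 0 v
  have h2 : ‖hessYY f 0 v‖ ≤ ℓ * ‖v‖ :=
    (norm_prY_le _).trans ((hf.norm_hessian_apply_le 0 (inY v)).trans_eq (by rw [norm_inY]))
  exact le_of_mul_le_mul_right (h1.trans h2) (norm_pos_iff.2 hv)

theorem prX_liftX (z : Joint dx dy) (u : Vec dx) : prX (liftX f z u) = u := by
  simp [liftX]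

theorem prX_hessian_liftX (z : Joint dx dy) (u : Vec dx) :
    prX (hessian f z (liftX f z u)) = schurHessian f z u := by
  simp [liftX, schurHessian, hessXX, hessXY]

theorem prY_hessian_liftX (hf : IsRegular f ℓ ρ μ) (z : Joint dx dy) (u : Vec dx) :
    prY (hessian f z (liftX f z u)) = 0 := by
  have h := (hf.isInvertible_hessYY z).self_apply_inverse (hessYX f z u)
  simp only [liftX, _root_.sub_apply, ContinuousLinearMap.comp_apply, map_sub]
  exact sub_eq_zero.2 h.symm

theorem inner_hessian_liftX (hf : IsRegular f ℓ ρ μ) (z : Joint dx dy) (u : Vec dx)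
    (w : Joint dx dy) :
    inner ℝ (hessian f z (liftX f z u)) w = inner ℝ (schurHessian f z u) (prX w) := by
  rw [inner_eq_prX_add_prY, hf.prY_hessian_liftX, prX_hessian_liftX, inner_zero_left, add_zero]

theorem isSymmetric_schurHessian (hf : IsRegular f ℓ ρ μ) (z : Joint dx dy) :
    (schurHessian f z).IsSymmetric := by
  intro u v
  have h1 := hf.inner_hessian_liftX z u (liftX f z v)
  have h2 := hf.inner_hessian_liftX z v (liftX f z u)
  have h3 : inner ℝ (hessian f z (liftX f z u)) (liftX f z v)
    = inner ℝ (liftX f z u) (hessian f z (liftX f z v)) := hf.isSymmetric_hessian z _ _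
  rw [prX_liftX] at h1 h2
  rw [h1, real_inner_comm _ (liftX f z u), h2, real_inner_comm u] at h3
  exact h3

/-- A vector with `x`-part `u` and `y`-part of norm at most `κ ‖u‖` has norm at most `√2 κ ‖u‖`,
since `κ ≥ 1`. -/
theorem norm_inX_add_inY_le {κ : ℝ} (hκ : 1 ≤ κ) {u : Vec dx} {v : Vec dy}
    (h : ‖v‖ ≤ κ * ‖u‖) : ‖(inX u + inY v : Joint dx dy)‖ ≤ √2 * κ * ‖u‖ := by
  have hκ0 : 0 ≤ κ := zero_le_one.trans hκ
  refine (sq_le_sq₀ (norm_nonneg _) (by positivity)).1 ?_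
  rw [norm_inX_add_inY_sq, mul_pow, mul_pow, Real.sq_sqrt zero_le_two]
  have h1 : ‖v‖ ^ 2 ≤ (κ * ‖u‖) ^ 2 := by gcongr
  have h2 : ‖u‖ ^ 2 ≤ (κ * ‖u‖) ^ 2 := by
    gcongr; exact le_mul_of_one_le_left (norm_nonneg _) hκ
  linarith [mul_pow κ ‖u‖ 2]

theorem norm_liftX_le (hf : IsRegular f ℓ ρ μ) (hdy : 0 < dy) (z : Joint dx dy) (u : Vec dx) :
    ‖liftX f z u‖ ≤ √2 * (ℓ / μ) * ‖u‖ := by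
  have hinv := hf.mul_norm_le_norm_hessYY z ((hessYY f z).inverse (hessYX f z u))
  rw [(hf.isInvertible_hessYY z).self_apply_inverse] at hinv
  have hyx : ‖hessYX f z u‖ ≤ ℓ * ‖u‖ :=
    (norm_prY_le _).trans ((hf.norm_hessian_apply_le z (inX u)).trans_eq (by rw [norm_inX]))
  have h : ‖-((hessYY f z).inverse (hessYX f z u))‖ ≤ ℓ / μ * ‖u‖ := by
    rw [norm_neg, div_mul_eq_mul_div, le_div_iff₀ hf.pos_μ, mul_comm]
    exact hinv.trans hyx
  have := norm_inX_add_inY_le (hf.one_le_conditionNumber hdy) h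
  simpa [liftX, sub_eq_add_neg] using this

/-- With `W = liftX f`, the Schur complements `S` satisfy
`S(z) - S(z') = W(z)ᵀ (∇²f(z) - ∇²f(z')) W(z')`, so that no difference of
inverse matrices has to be estimated. -/
theorem norm_schurHessian_sub_le (hf : IsRegular f ℓ ρ μ) (hdy : 0 < dy) (z z' : Joint dx dy) :
    ‖schurHessian f z - schurHessian f z'‖ ≤ 2 * (ℓ / μ) ^ 2 * ρ * ‖z - z'‖ := by
  have hℓ := hf.pos_ℓ
  have hμ := hf.pos_μ
  have hρ := hf.pos_ρ
  refine ContinuousLinearMap.opNorm_le_bound _ (by positivity) fun v => ?_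
  have hinner : ∀ u, inner ℝ u ((schurHessian f z - schurHessian f z') v) =
      inner ℝ (liftX f z u) ((hessian f z - hessian f z') (liftX f z' v)) := by
    intro u
    have h1 := hf.inner_hessian_liftX z u (liftX f z' v)
    have h2 := hf.inner_hessian_liftX z' v (liftX f z u)
    have h3 : inner ℝ (hessian f z (liftX f z u)) (liftX f z' v)
      = inner ℝ (liftX f z u) (hessian f z (liftX f z' v)) := hf.isSymmetric_hessian z _ _
    have h4 : inner ℝ (schurHessian f z u) v = inner ℝ u (schurHessian f z v) :=
      hf.isSymmetric_schurHessian z u v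
    rw [prX_liftX] at h1 h2
    rw [_root_.sub_apply, _root_.sub_apply, inner_sub_right,
      inner_sub_right, ← h3, h1, h4, real_inner_comm _ (liftX f z u), h2,
      real_inner_comm u]
  set w := (schurHessian f z - schurHessian f z') v with hw
  have hop : ‖(hessian f z - hessian f z') (liftX f z' v)‖ ≤
      ρ * ‖z - z'‖ * (√2 * (ℓ / μ) * ‖v‖) :=
    (ContinuousLinearMap.le_of_opNorm_le _ (hf.hessian_lipschitz z z') _).trans
      (by gcongr; exact hf.norm_liftX_le hdy z' v)
  have hsq : ‖w‖ * ‖w‖ ≤ ‖w‖ * (2 * (ℓ / μ) ^ 2 * ρ * ‖z - z'‖ * ‖v‖) := by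
    calc ‖w‖ * ‖w‖ = inner ℝ w w := (real_inner_self_eq_norm_mul_norm w).symm
      _ = inner ℝ (liftX f z w) ((hessian f z - hessian f z') (liftX f z' v)) := hinner w
      _ ≤ ‖liftX f z w‖ * ‖(hessian f z - hessian f z') (liftX f z' v)‖ := real_inner_le_norm _ _
      _ ≤ (√2 * (ℓ / μ) * ‖w‖) * (ρ * ‖z - z'‖ * (√2 * (ℓ / μ) * ‖v‖)) := by
          gcongr; exact hf.norm_liftX_le hdy z w
      _ = √2 ^ 2 * (‖w‖ * ((ℓ / μ) ^ 2 * ρ * ‖z - z'‖ * ‖v‖)) := by ring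
      _ = ‖w‖ * (2 * (ℓ / μ) ^ 2 * ρ * ‖z - z'‖ * ‖v‖) := by
          rw [Real.sq_sqrt zero_le_two]; ring
  rcases (norm_nonneg w).eq_or_lt with h0 | h0
  · rw [← h0]; positivity
  · exact le_of_mul_le_mul_left hsq h0

end Schur

/-! ### The maximizer and the primal function -/

section Primal

theorem exists_argmax (hf : IsRegular f ℓ ρ μ) :
    ∃ Y : Vec dx → Vec dy, ∀ x y, f (pair x y) ≤ f (pair x (Y x)) :=
  Classical.skolem.1 fun x => exists_forall_le_of_strongConcaveOn hf.pos_μ (hf.strongConcave x)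
    (fun v => (hasGradientAt_slice hf.differentiable x v).differentiableAt)

variable {Y : Vec dx → Vec dy}

theorem primal_eq (hY : ∀ x y, f (pair x y) ≤ f (pair x (Y x))) (x : Vec dx) :
    primal f x = f (pair x (Y x)) :=
  le_antisymm (ciSup_le (hY x)) (le_ciSup (f := fun y => f (pair x y))
    ⟨f (pair x (Y x)), by rintro _ ⟨y, rfl⟩; exact hY x y⟩ (Y x))

theorem gradY_argmax (hf : IsRegular f ℓ ρ μ) (hY : ∀ x y, f (pair x y) ≤ f (pair x (Y x)))
    (x : Vec dx) : prY (∇ f (pair x (Y x))) = 0 := by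
  have hmax : IsLocalMax (fun v => f (pair x v)) (Y x) := Eventually.of_forall (hY x)
  have h := hmax.hasFDerivAt_eq_zero
    (hasGradientAt_slice hf.differentiable x (Y x)).hasFDerivAt
  exact (map_eq_zero_iff _ (InnerProductSpace.toDual ℝ (Vec dy)).injective).1 h

theorem norm_argmax_sub_le (hf : IsRegular f ℓ ρ μ)
    (hY : ∀ x y, f (pair x y) ≤ f (pair x (Y x))) (x x' : Vec dx) :
    ‖Y x - Y x'‖ ≤ ℓ / μ * ‖x - x'‖ := by
  have hmono := hf.inner_gradY_sub_le x (Y x) (Y x')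
  rw [hf.gradY_argmax hY, ← hf.gradY_argmax hY x'] at hmono
  have hlip : ‖prY (∇ f (pair x' (Y x'))) - prY (∇ f (pair x (Y x')))‖ ≤ ℓ * ‖x - x'‖ := by
    rw [← map_sub]
    refine (norm_prY_le _).trans ((hf.gradient_lipschitz _ _).trans_eq ?_)
    rw [pair_sub_pair, sub_self, map_zero, add_zero, norm_inX, norm_sub_rev]
  have hcs := neg_le_of_abs_le (abs_real_inner_le_norm
    (prY (∇ f (pair x' (Y x'))) - prY (∇ f (pair x (Y x')))) (Y x - Y x'))
  have hbound := mul_le_mul_of_nonneg_right hlip (norm_nonneg (Y x - Y x'))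
  rw [div_mul_eq_mul_div, le_div_iff₀ hf.pos_μ]
  rcases (norm_nonneg (Y x - Y x')).eq_or_lt with h0 | h0
  · rw [← h0, zero_mul]; exact mul_nonneg hf.pos_ℓ.le (norm_nonneg _)
  · refine le_of_mul_le_mul_right ?_ h0
    linarith

theorem norm_pair_argmax_sub_le (hf : IsRegular f ℓ ρ μ) (hdy : 0 < dy)
    (hY : ∀ x y, f (pair x y) ≤ f (pair x (Y x))) (x x' : Vec dx) :
    ‖pair x (Y x) - pair x' (Y x')‖ ≤ √2 * (ℓ / μ) * ‖x - x'‖ := by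
  rw [pair_sub_pair]
  exact norm_inX_add_inY_le (hf.one_le_conditionNumber hdy) (hf.norm_argmax_sub_le hY x x')

/-- The implicit function theorem for `∇ᵧ f (x, Y x) = 0`. As `Y` is already known to be Lipschitz,
the first-order expansion of `∇ᵧ f` can be solved for `Y x' - Y x`. -/
theorem hasFDerivAt_argmax (hf : IsRegular f ℓ ρ μ) (hdy : 0 < dy)
    (hY : ∀ x y, f (pair x y) ≤ f (pair x (Y x))) (x : Vec dx) :
    HasFDerivAt Y (-((hessYY f (pair x (Y x))).inverse ∘L hessYX f (pair x (Y x)))) x := by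
  set z := pair x (Y x) with hz
  have hinv := hf.isInvertible_hessYY z
  have hO : (fun x' => pair x' (Y x') - z) =O[𝓝 x] fun x' => x' - x :=
    Asymptotics.IsBigO.of_bound _ (Eventually.of_forall fun x' =>
      hf.norm_pair_argmax_sub_le hdy hY x' x)
  have hcont : Tendsto (fun x' => pair x' (Y x')) (𝓝 x) (𝓝 z) := by
    rw [tendsto_iff_norm_sub_tendsto_zero]
    have h0 : Tendsto (fun x' => x' - x) (𝓝 x) (𝓝 0) := by
      simpa using (continuous_id.sub continuous_const).tendsto (x := x) (f := fun x' => x' - x)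
    exact tendsto_zero_iff_norm_tendsto_zero.1 (hO.trans_tendsto h0)
  have hG : HasFDerivAt (fun w => prY (∇ f w)) (prY ∘L hessian f z) z :=
    (prY : Joint dx dy →L[ℝ] Vec dy).hasFDerivAt.comp z
      (hf.differentiable_gradient z).hasFDerivAt
  have ho := (hG.isLittleO.comp_tendsto hcont).trans_isBigO hO
  refine HasFDerivAt.of_isLittleO
    ((((-(hessYY f z).inverse).isBigO_comp _ _).trans_isLittleO ho).congr_left fun x' => ?_)
  have h1 : (hessYY f z).inverse (hessYY f z (Y x' - Y x)) = Y x' - Y x :=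
    hinv.inverse_apply_self _
  have h2 : prY (hessian f z (pair x' (Y x') - z)) =
      hessYX f z (x' - x) + hessYY f z (Y x' - Y x) := by
    rw [hz, pair_sub_pair, map_add, map_add]; rfl
  have h3 : prY (∇ f z) = 0 := hf.gradY_argmax hY x
  simp only [Function.comp_apply, ContinuousLinearMap.comp_apply, h2, hf.gradY_argmax hY, h3]
  rw [sub_zero, zero_sub, _root_.neg_apply, map_neg, neg_neg, map_add, h1,
    _root_.neg_apply, ContinuousLinearMap.comp_apply]
  abel

theorem hasFDerivAt_pair_argmax (hf : IsRegular f ℓ ρ μ) (hdy : 0 < dy)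
    (hY : ∀ x y, f (pair x y) ≤ f (pair x (Y x))) (x : Vec dx) :
    HasFDerivAt (fun x' => pair x' (Y x')) (liftX f (pair x (Y x))) x := by
  simp_rw [pair_eq]
  refine ((inX : Vec dx →L[ℝ] Joint dx dy).hasFDerivAt.add
    ((inY : Vec dy →L[ℝ] Joint dx dy).hasFDerivAt.comp x
      (hf.hasFDerivAt_argmax hdy hY x))).congr_fderiv ?_
  ext1 u
  simp [liftX, pair_eq, sub_eq_add_neg]

theorem hasGradientAt_primal (hf : IsRegular f ℓ ρ μ) (hdy : 0 < dy)
    (hY : ∀ x y, f (pair x y) ≤ f (pair x (Y x))) (x : Vec dx) :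
    HasGradientAt (primal f) (gradX f (pair x (Y x))) x := by
  have hP : primal f = fun x => f (pair x (Y x)) := funext (primal_eq hY)
  rw [hasGradientAt_iff_hasFDerivAt, hP]
  refine ((hf.differentiable _).hasFDerivAt.comp x
    (hf.hasFDerivAt_pair_argmax hdy hY x)).congr_fderiv ?_
  ext1 u
  rw [ContinuousLinearMap.comp_apply, ← inner_gradient_left, inner_eq_prX_add_prY,
    hf.gradY_argmax hY, prX_liftX, inner_zero_left, add_zero]
  rfl

theorem gradient_primal (hf : IsRegular f ℓ ρ μ) (hdy : 0 < dy)
    (hY : ∀ x y, f (pair x y) ≤ f (pair x (Y x))) :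
    ∇ (primal f) = fun x => prX (∇ f (pair x (Y x))) :=
  funext fun x => (hf.hasGradientAt_primal hdy hY x).gradient

theorem hasFDerivAt_gradient_primal (hf : IsRegular f ℓ ρ μ) (hdy : 0 < dy)
    (hY : ∀ x y, f (pair x y) ≤ f (pair x (Y x))) (x : Vec dx) :
    HasFDerivAt (∇ (primal f)) (schurHessian f (pair x (Y x))) x := by
  rw [hf.gradient_primal hdy hY]
  refine ((prX : Joint dx dy →L[ℝ] Vec dx).hasFDerivAt.comp x
    ((hf.differentiable_gradient _).hasFDerivAt.comp x
      (hf.hasFDerivAt_pair_argmax hdy hY x))).congr_fderiv ?_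
  ext1 u
  exact prX_hessian_liftX _ u

theorem differentiable_primal (hf : IsRegular f ℓ ρ μ) (hdy : 0 < dy) :
    Differentiable ℝ (primal f) := by
  obtain ⟨Y, hY⟩ := hf.exists_argmax
  exact fun x => (hf.hasGradientAt_primal hdy hY x).differentiableAt

theorem differentiable_gradient_primal (hf : IsRegular f ℓ ρ μ) (hdy : 0 < dy) :
    Differentiable ℝ (∇ (primal f)) := by
  obtain ⟨Y, hY⟩ := hf.exists_argmax
  exact fun x => (hf.hasFDerivAt_gradient_primal hdy hY x).differentiableAt

theorem norm_hessian_primal_sub_le (hf : IsRegular f ℓ ρ μ) (hdy : 0 < dy) (x x' : Vec dx) :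
    ‖hessian (primal f) x - hessian (primal f) x'‖ ≤ 2 * √2 * (ℓ / μ) ^ 3 * ρ * ‖x - x'‖ := by
  obtain ⟨Y, hY⟩ := hf.exists_argmax
  have hρ := hf.pos_ρ
  unfold hessian
  rw [(hf.hasFDerivAt_gradient_primal hdy hY x).fderiv,
    (hf.hasFDerivAt_gradient_primal hdy hY x').fderiv]
  calc _ ≤ 2 * (ℓ / μ) ^ 2 * ρ * ‖pair x (Y x) - pair x' (Y x')‖ :=
        hf.norm_schurHessian_sub_le hdy _ _
    _ ≤ 2 * (ℓ / μ) ^ 2 * ρ * (√2 * (ℓ / μ) * ‖x - x'‖) := by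
        gcongr; exact hf.norm_pair_argmax_sub_le hdy hY x x'
    _ = _ := by ring

end Primal

end IsRegular

/-! ### One inexact cubic Newton step -/

section Step

variable {d : ℕ} {φ : Vec d → ℝ} {M ε : ℝ} {x g s : Vec d} {H : Vec d →L[ℝ] Vec d}

theorem mul_sqrt_div_sq (hM : 0 < M) (hε : 0 < ε) : M * √(ε / M) ^ 2 = ε := by
  rw [Real.sq_sqrt (by positivity)]; field_simp

theorem sqrt_mul_eq_mul_sqrt_div (hM : 0 < M) (hε : 0 < ε) : √(M * ε) = M * √(ε / M) := by
  rw [Real.sqrt_eq_iff_mul_self_eq (by positivity) (by positivity)]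
  linear_combination (-M) * mul_sqrt_div_sq hM hε

theorem abs_inner_sub_apply_le {A B : Vec d →L[ℝ] Vec d} {c : ℝ} (h : ‖A - B‖ ≤ c) (v : Vec d) :
    |inner ℝ v (A v) - inner ℝ v (B v)| ≤ c * ‖v‖ ^ 2 := by
  rw [← inner_sub_right, ← _root_.sub_apply]
  refine (abs_real_inner_le_norm _ _).trans ?_
  have := mul_le_mul_of_nonneg_left ((A - B).le_of_opNorm_le h v) (norm_nonneg v)
  linarith

/-- A step longer than `√(ε / M) / 2` decreases `φ` by more than `M √(ε / M) ^ 3 / 192`, which is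
`ε ^ (3 / 2) / (192 √M)`. -/
theorem cubicStep_decrease (hM : 0 < M) (hε : 0 < ε) (h1 : Differentiable ℝ φ)
    (h2 : Differentiable ℝ (∇ φ))
    (hlip : ∀ z z', ‖hessian φ z - hessian φ z'‖ ≤ M / 2 * ‖z - z'‖) (hH : H.IsSymmetric)
    (hs : ∀ u, cubicModel g H M s ≤ cubicModel g H M u) (hg : ‖∇ φ x - g‖ ≤ 1 / 192 * ε)
    (hHx : ‖hessian φ x - H‖ ≤ 1 / 48 * √(M * ε)) (hlong : 1 / 2 * √(ε / M) < ‖s‖) :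
    φ (x + s) < φ x - M * √(ε / M) ^ 3 / 192 := by
  have htaylor := le_taylor_add_cube (by positivity : 0 ≤ M / 2) h1 h2 hlip x s
  have hmodel := cubicModel_le hH hM.le hs
  unfold cubicModel at hmodel
  have hgs := (real_inner_le_norm (∇ φ x - g) s).trans
    (mul_le_mul_of_nonneg_right hg (norm_nonneg s))
  rw [inner_sub_left] at hgs
  have hHs := (abs_le.1 (abs_inner_sub_apply_le hHx s)).2
  rw [sqrt_mul_eq_mul_sqrt_div hM hε] at hHs
  have hεq := mul_sqrt_div_sq hM hε
  set q := √(ε / M)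
  have hq : 0 ≤ q := Real.sqrt_nonneg _
  set r := ‖s‖
  have hr : 0 ≤ r := norm_nonneg _
  -- As `q < 2 r`, each of the two error terms `ε r / 192` and `M q r ^ 2 / 96` is at most
  -- `M r ^ 3 / 48`, which leaves a decrease of `M r ^ 3 / 24` out of `M r ^ 3 / 12`.
  have hq3 : q ^ 3 < (2 * r) ^ 3 := by gcongr; linarith
  have hq2 : q ^ 2 * r ≤ (2 * r) ^ 2 * r := by gcongr; linarith
  have hq1 : q * r ^ 2 ≤ (2 * r) * r ^ 2 := by gcongr; linarith
  have hq3' := mul_lt_mul_of_pos_left hq3 hM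
  have hq2' := mul_le_mul_of_nonneg_left hq2 hM.le
  have hq1' := mul_le_mul_of_nonneg_left hq1 hM.le
  rw [← hεq] at hgs
  linarith

/-- A step of length at most `√(ε / M) / 2` leads to an `(ε, √(M ε))`-second-order stationary
point. -/
theorem cubicStep_isSSP (hM : 0 < M) (hε : 0 < ε) (h1 : Differentiable ℝ φ)
    (h2 : Differentiable ℝ (∇ φ))
    (hlip : ∀ z z', ‖hessian φ z - hessian φ z'‖ ≤ M / 2 * ‖z - z'‖) (hH : H.IsSymmetric)
    (hs : ∀ u, cubicModel g H M s ≤ cubicModel g H M u) (hg : ‖∇ φ x - g‖ ≤ 1 / 192 * ε)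
    (hHx : ‖hessian φ x - H‖ ≤ 1 / 48 * √(M * ε)) (hshort : ‖s‖ ≤ 1 / 2 * √(ε / M)) :
    IsSSP φ ε √(M * ε) (x + s) := by
  have hεq := mul_sqrt_div_sq hM hε
  refine ⟨Eventually.of_forall h1, h2 _, ?_, ?_⟩
  · have hopt := cubicModel_gradient_eq_zero hH hs
    have hsplit : ∇ φ (x + s) = (∇ φ (x + s) - ∇ φ x - hessian φ x s) + (∇ φ x - g)
        + (hessian φ x - H) s - (M / 2 * ‖s‖) • s := by
      rw [_root_.sub_apply, ← sub_eq_zero, ← hopt]; abel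
    have ha := norm_gradient_add_sub_le (by positivity : 0 ≤ M / 2) h2 hlip x s
    have hb := (hessian φ x - H).le_of_opNorm_le hHx s
    have hc : ‖(M / 2 * ‖s‖) • s‖ = M / 2 * ‖s‖ ^ 2 := by
      rw [norm_smul, Real.norm_of_nonneg (by positivity)]; ring
    have hn : ‖∇ φ (x + s)‖ ≤ ‖∇ φ (x + s) - ∇ φ x - hessian φ x s‖ + ‖∇ φ x - g‖
        + ‖(hessian φ x - H) s‖ + ‖(M / 2 * ‖s‖) • s‖ := by
      conv_lhs => rw [hsplit]
      refine (norm_sub_le _ _).trans ?_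
      gcongr
      exact norm_add₃_le
    rw [hc] at hn
    rw [sqrt_mul_eq_mul_sqrt_div hM hε] at hb
    set q := √(ε / M)
    have hq : 0 ≤ q := Real.sqrt_nonneg _
    have hr2 : ‖s‖ ^ 2 ≤ (1 / 2 * q) ^ 2 := by gcongr
    have hr1 : q * ‖s‖ ≤ q * (1 / 2 * q) := by gcongr
    have hr2' := mul_le_mul_of_nonneg_left hr2 hM.le
    have hr1' := mul_le_mul_of_nonneg_left hr1 hM.le
    linarith
  · rw [ContinuousLinearMap.isPositive_iff]
    refine ⟨fun u v => ?_, fun v => ?_⟩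
    · have := isSymmetric_hessian h1 (h2 (x + s)) u v
      simpa [inner_add_left, inner_add_right, real_inner_smul_left, real_inner_smul_right]
        using this
    · have ha := (abs_le.1 (abs_inner_sub_apply_le (hlip (x + s) x) v)).1
      have hb := (abs_le.1 (abs_inner_sub_apply_le hHx v)).1
      have hc := cubicModel_second_order hH hM.le hs v
      rw [add_sub_cancel_left] at ha
      rw [sqrt_mul_eq_mul_sqrt_div hM hε] at hb ⊢
      simp only [_root_.add_apply, _root_.smul_apply, ContinuousLinearMap.id_apply,
        inner_add_left, real_inner_smul_left, real_inner_self_eq_norm_sq]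
      rw [real_inner_comm]
      set q := √(ε / M)
      have hq : 0 ≤ q := Real.sqrt_nonneg _
      have hr : M * ‖v‖ ^ 2 * ‖s‖ ≤ M * ‖v‖ ^ 2 * (1 / 2 * q) := by gcongr
      have hpos : 0 ≤ M * ‖v‖ ^ 2 * q := by positivity
      linarith

end Step

/-- The number of rounds offsets the decrease guaranteed in each of them. -/
theorem le_mul_decrease {M ε Δ N : ℝ} (hM : 0 < M) (hε : 0 < ε)
    (hN : 192 * Δ * √M * ε ^ (-(3 / 2) : ℝ) ≤ N) : Δ ≤ N * (M * √(ε / M) ^ 3 / 192) := by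
  have hpow : √ε ^ 3 * ε ^ (-(3 / 2) : ℝ) = 1 := by
    rw [Real.sqrt_eq_rpow, ← Real.rpow_natCast, ← Real.rpow_mul hε.le, ← Real.rpow_add hε]
    norm_num
  have hdec : √M * (M * √(ε / M) ^ 3) = √ε ^ 3 := by
    have hsM : 0 < √M := Real.sqrt_pos.2 hM
    rw [Real.sqrt_div hε.le]
    nth_rewrite 2 [← Real.sq_sqrt hM.le]
    field_simp
  have h := mul_le_mul_of_nonneg_right hN (by positivity : 0 ≤ M * √(ε / M) ^ 3 / 192)
  refine le_of_eq_of_le ?_ h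
  linear_combination (-Δ) * hpow - Δ * ε ^ (-(3 / 2) : ℝ) * hdec

end Minimax

theorem mainTheorem1 {dx dy : ℕ} (hdy : 0 < dy) (f : Minimax.Joint dx dy → ℝ)
    (ℓ ρ μ : ℝ) (hℓ : 0 < ℓ) (hρ : 0 < ρ) (hμ : 0 < μ)
    -- `f` is twice differentiable, with `ℓ`-Lipschitz gradient and `ρ`-Lipschitz Hessian
    (hf : Differentiable ℝ f) (hf' : Differentiable ℝ (gradient f))
    (hgrad : ∀ z z' : Minimax.Joint dx dy, ‖gradient f z - gradient f z'‖ ≤ ℓ * ‖z - z'‖)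
    (hhess : ∀ z z' : Minimax.Joint dx dy,
      ‖Minimax.hessian f z - Minimax.hessian f z'‖ ≤ ρ * ‖z - z'‖)
    -- `f` is `μ`-strongly concave in `y`
    (hconc : ∀ x : Minimax.Vec dx,
      StrongConcaveOn Set.univ μ (fun y : Minimax.Vec dy => f (Minimax.pair x y)))
    -- `P` is bounded below
    (hP : BddBelow (Set.range (Minimax.primal f)))
    (ε : ℝ) (hε : 0 < ε) (x₀ : Minimax.Vec dx)
    (κ : ℝ) (hκ : κ = ℓ / μ) (M : ℝ) (hM : M = 4 * √2 * κ ^ 3 * ρ)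
    (T : ℕ)
    (hT : T = ⌈192 * (Minimax.primal f x₀ - ⨅ x, Minimax.primal f x) * √M *
      ε ^ (-(3 / 2) : ℝ)⌉₊ + 1)
    -- a run of the algorithm
    (K : ℕ → ℕ) (x : ℕ → Minimax.Vec dx) (y : ℕ → Minimax.Vec dy) (s : ℕ → Minimax.Vec dx)
    (τ : ℕ) (hrun : Minimax.IsMCNRun f ℓ κ M x₀ T K ε x y s τ)
    -- accuracy of `g_t` and `H_t` in every round, with `C_g = 1/192` and `C_H = 1/48`
    (hg : ∀ t ≤ τ, ‖gradient (Minimax.primal f) (x t) -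
      Minimax.gradX f (Minimax.pair (x t) (y t))‖ ≤ 1 / 192 * ε)
    (hH : ∀ t ≤ τ, ‖Minimax.hessian (Minimax.primal f) (x t) -
      Minimax.schurHessian f (Minimax.pair (x t) (y t))‖ ≤ 1 / 48 * √(M * ε)) :
    Minimax.IsSSP (Minimax.primal f) ε √(M * ε) (x τ + s τ) := by
  have hreg : Minimax.IsRegular f ℓ ρ μ := ⟨hℓ, hρ, hμ, hf, hf', hgrad, hhess, hconc⟩
  have hMpos : 0 < M := by rw [hM, hκ]; positivity
  have h1 := hreg.differentiable_primal hdy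
  have h2 := hreg.differentiable_gradient_primal hdy
  have hlip : ∀ z z', ‖Minimax.hessian (Minimax.primal f) z
      - Minimax.hessian (Minimax.primal f) z'‖ ≤ M / 2 * ‖z - z'‖ := fun z z' =>
    (hreg.norm_hessian_primal_sub_le hdy z z').trans_eq (by rw [hM, hκ]; ring)
  refine Minimax.cubicStep_isSSP hMpos hε h1 h2 hlip (hreg.isSymmetric_schurHessian _)
    (hrun.s_min τ le_rfl) (hg τ le_rfl) (hH τ le_rfl) (hrun.last_round.elim id fun hτ => ?_)
  -- If the loop ended without a break, `T` long steps would bring `P` below its infimum.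
  by_contra hbreak
  set c := M * √(ε / M) ^ 3 / 192
  have hdec : ∀ t ≤ τ, Minimax.primal f (x t + s t) < Minimax.primal f (x t) - c := by
    intro t ht
    refine Minimax.cubicStep_decrease hMpos hε h1 h2 hlip (hreg.isSymmetric_schurHessian _)
      (hrun.s_min t ht) (hg t ht) (hH t ht) ?_
    rcases ht.eq_or_lt with rfl | hlt
    · exact not_le.1 hbreak
    · exact not_le.1 (hrun.no_break t hlt)
  have hsum : ∀ t ≤ τ, Minimax.primal f (x t) ≤ Minimax.primal f x₀ - t * c := by
    intro t
    induction t with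
    | zero => intro _; simp [hrun.x_zero]
    | succ t ih =>
      intro ht
      rw [hrun.x_succ t ht, Nat.cast_succ]
      linarith [hdec t (Nat.le_of_succ_le ht), ih (Nat.le_of_succ_le ht)]
  have hτ' : τ = ⌈192 * (Minimax.primal f x₀ - ⨅ x, Minimax.primal f x) * √M *
      ε ^ (-(3 / 2) : ℝ)⌉₊ := by omega
  have hN : Minimax.primal f x₀ - ⨅ x, Minimax.primal f x ≤ τ * c :=
    Minimax.le_mul_decrease (N := τ) hMpos hε (hτ' ▸ Nat.le_ceil _)
  have hcpos : 0 < c := by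
    have : 0 < √(ε / M) := Real.sqrt_pos.2 (by positivity)
    positivity
  linarith [hdec τ le_rfl, hsum τ le_rfl, ciInf_le hP (x τ + s τ)]
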